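/- Let $m,n\ge 0$ be integers with $m\ge 1$ or $n=0$. An $(m,n)$-word is a word $w=w_1\cdots w_n$ of length $n$ on the alphabet $\{0,1,\dots,m+1\}$ such that $w_1\neq m+1$ (when $n\ge 1$) and such that, for every $s\in\{1,\dots,m\}$, $w_i=s$ implies $w_j\ge s$ for all $j<i$. Let $W(m,n)$ be the set of $(m,n)$-words ordered by $w\le w'$ if and only if $w_i\le w'_i$ for all $i\in\{1,\dots,n\}$; it is called the $(m,n)$-word lattice. The order dimension $\dim(P)$ of a poset $P$ is the smallest integer $d\ge 0$ such that $P$ is isomorphic to a subposet of $\mathbb{R}^d$ with the product order. Then $$\dim(W(m,n))=n.$$ -/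

import Mathlib

/-- The order dimension of a poset `P`: the smallest `d : ℕ` such that `P` is isomorphic to a
subposet of `ℝ^d` with the product order (and `⊤` if there is no such `d`). -/
noncomputable def orderDimension (P : Type*) [PartialOrder P] : ℕ∞ :=
  ⨅ (d : ℕ) (_ : Nonempty (P ↪o (Fin d → ℝ))), (d : ℕ∞)

/-- `w` is an `(m,n)`-word: a word of length `n` on the alphabet `{0, 1, …, m+1}` whose first
letter (if there is one) is not `m+1`, and such that every letter `s` with `1 ≤ s ≤ m` is preceded
only by letters `≥ s`. Positions are numbered from `0`. -/
def IsMNWord (m n : ℕ) (w : Fin n → Fin (m + 2)) : Prop :=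
  (∀ i : Fin n, (i : ℕ) = 0 → (w i : ℕ) ≠ m + 1) ∧
  ∀ s : ℕ, 1 ≤ s → s ≤ m → ∀ i : Fin n, (w i : ℕ) = s → ∀ j : Fin n, j < i → s ≤ (w j : ℕ)

/-- The `(m,n)`-word lattice `W(m,n)`: the `(m,n)`-words, ordered letter by letter
(the order is the one that a subtype inherits from the product order). -/
abbrev WordLattice (m n : ℕ) : Type := {w : Fin n → Fin (m + 2) // IsMNWord m n w}

/-! Letters already embed the lattice in `ℝ^n`. Conversely, spikes and dips form a standard example
of size `n`: the letter `m + 1` may follow zeros, so spikes are words, and `spikeWord i` exceeds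
`dipWord i` at position `i` only. -/

/-- A standard example of size `n` in `P` forces any embedding of `P` into `ℝ^d` to have
`n ≤ d`: a coordinate reverses at most one of the pairs `(a i, b i)`. -/
theorem le_of_standardExample {P : Type*} [PartialOrder P] {n d : ℕ} (a b : Fin n → P)
    (hab : ∀ i, ¬ a i ≤ b i) (hne : ∀ i j, i ≠ j → a i ≤ b j) (f : P ↪o (Fin d → ℝ)) :
    n ≤ d := by
  have h : ∀ i, ∃ k, f (b i) k < f (a i) k := by
    intro i
    have hi := hab i
    rw [← f.le_iff_le, Pi.le_def] at hi
    push Not at hi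
    exact hi
  choose g hg using h
  have hinj : Function.Injective g := by
    intro i j hij
    by_contra hne'
    -- In coordinate `g i = g j` this gives the cycle `a i ≤ b j < a j ≤ b i < a i`.
    have h1 := f.le_iff_le.2 (hne i j hne') (g i)
    have h2 := f.le_iff_le.2 (hne j i (Ne.symm hne')) (g i)
    have h3 := hg i
    have h4 := hg j
    rw [← hij] at h4
    linarith
  simpa using Fintype.card_le_of_injective g hinj

/-- The inclusion of the word lattice into `ℝ^n`. -/
def wordEmbedding (m n : ℕ) : WordLattice m n ↪o (Fin n → ℝ) where
  toFun w i := ((w.1 i : ℕ) : ℝ)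
  inj' w w' h := by
    ext i
    exact Nat.cast_injective (R := ℝ) (congrFun h i)
  map_rel_iff' {w w'} := by
    exact forall_congr' fun i => Nat.cast_le (α := ℝ)

/-- The word whose only nonzero letter is at position `i`, where it is `m + 1`
(or `1` at the initial position). -/
def spikeWord {m n : ℕ} (hm : 1 ≤ m) (i : Fin n) : WordLattice m n :=
  ⟨fun k => ⟨if k = i then (if (i : ℕ) = 0 then 1 else m + 1) else 0, by split_ifs <;> omega⟩, by
    refine ⟨fun k hk => ?_, fun s hs hsm k hk j hj => ?_⟩
    · dsimp only
      split_ifs <;> omega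
    · dsimp only at hk ⊢
      rw [Fin.lt_def] at hj
      split_ifs at hk <;> omega⟩

/-- The largest word whose letter at position `i` is smaller than that of `spikeWord i`. -/
def dipWord {m n : ℕ} (i : Fin n) : WordLattice m n :=
  ⟨fun k => ⟨if k = i then (if (i : ℕ) = 0 then 0 else m) else if (k : ℕ) = 0 then m else m + 1,
    by split_ifs <;> omega⟩, by
    refine ⟨fun k hk => ?_, fun s hs hsm k hk j hj => ?_⟩
    · dsimp only
      split_ifs <;> omega
    · dsimp only at hk ⊢
      rw [Fin.lt_def] at hj
      split_ifs at hk ⊢ <;> omega⟩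

theorem not_spikeWord_le_dipWord {m n : ℕ} (hm : 1 ≤ m) (i : Fin n) :
    ¬ spikeWord hm i ≤ dipWord i := by
  intro h
  have hi : (if i = i then (if (i : ℕ) = 0 then 1 else m + 1) else 0) ≤
      (if i = i then (if (i : ℕ) = 0 then 0 else m) else if (i : ℕ) = 0 then m else m + 1) := h i
  split_ifs at hi <;> omega

theorem spikeWord_le_dipWord {m n : ℕ} (hm : 1 ≤ m) (i j : Fin n) (hij : i ≠ j) :
    spikeWord hm i ≤ dipWord j := by
  intro k
  change (if k = i then (if (i : ℕ) = 0 then 1 else m + 1) else 0) ≤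
      (if k = j then (if (j : ℕ) = 0 then 0 else m) else if (k : ℕ) = 0 then m else m + 1)
  -- For `k = i = 0` the inequality is `1 ≤ m`.
  split_ifs <;> omega

theorem mainTheorem11 (m n : ℕ) (hmn : 1 ≤ m ∨ n = 0) :
    orderDimension (WordLattice m n) = (n : ℕ∞) := by
  apply le_antisymm
  · exact iInf₂_le n ⟨wordEmbedding m n⟩
  · refine le_iInf₂ fun d ⟨f⟩ => ?_
    rcases hmn with hm | rfl
    · exact_mod_cast le_of_standardExample (spikeWord hm) dipWord
        (not_spikeWord_le_dipWord hm) (spikeWord_le_dipWord hm) f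
    · simp
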